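/- **Model.** Consider an M/M/1 feedback queue under first-come-first-served with Poisson arrivals of rate $\lambda>0$ and exponential service attempts of rate $\mu>0$. Each attempt succeeds with probability $q\in(0,1]$, in which case the customer leaves; otherwise she rejoins the end of the queue. Customers cannot renege, and the system starts empty. For $x\ge 0$ the threshold strategy $\mathcal T(x)$ is to join, when the position upon joining would be $i$, with probability $u^{(x)}(i)=1$ if $i\le\lfloor x\rfloor$, $u^{(x)}(i)=x-\lfloor x\rfloor$ if $i=\lfloor x\rfloor+1$, and $u^{(x)}(i)=0$ if $i\ge\lfloor x\rfloor+2$. Let $W^{(x)}_{i,j}$ be the remaining sojourn time of a tagged customer who is in position $i$ when $j$ customers (including herself) are present, if all other customers use $\mathcal T(x)$. For a discount rate $\alpha\ge 0$ and an admission fee $v\in\mathbb R$ put $$z^{(x)}_{i,j}(\alpha)=\mathbb E\big[e^{-\alpha W^{(x)}_{i,j}}\big]-v .$$ A customer who joins in position $i$ gets expected payoff $z^{(x)}_{i,i}(\alpha)$; one who balks gets $0$. A number $x\ge0$ is a (symmetric) Nash equilibrium threshold if, when all others use $\mathcal T(x)$, a tagged customer cannot increase her expected payoff by deviating from $\mathcal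 T(x)$, whatever number of customers in $\{0,\dots,\lceil x\rceil\}$ (the numbers that can occur) she finds on arrival. **Theorem.** Let $\alpha\ge0$. 1. If $z^{(0)}_{1,1}(\alpha)<0$, then $0$ is the unique Nash equilibrium threshold. 2. If $z^{(0)}_{1,1}(\alpha)=0$, then every $\zeta_0\in[0,1]$ is a Nash equilibrium threshold; if moreover $\alpha>0$, there are no others. 3. If $m\ge1$ is an integer with $z^{(m)}_{m+1,m+1}(\alpha)\le0\le z^{(m)}_{m,m}(\alpha)$, then $m$ is a Nash equilibrium threshold; if moreover $\alpha>0$, $q<1$ and $z^{(0)}_{1,1}(\alpha)\ne0$, it is the only one. 4. If $m\ge1$ is an integer with $z^{(m+1)}_{m+1,m+1}(\alpha)<0<z^{(m)}_{m+1,m+1}(\alpha)$, then the equation $z^{(x)}_{m+1,m+1}(\alpha)=0$ has exactly one root $\chi_m$ in $(m,m+1)$, and $\chi_m$ is the unique Nash equilibrium threshold. If $\alpha>0$ and $v>0$, then the condition of at least one of 1–4 holds (in 3 and 4 for some integer $m\ge1$). -/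

import Mathlib

open MeasureTheory ProbabilityTheory Set

noncomputable section

/-- Parameters of an M/M/1 feedback queue: Poisson arrivals at rate `arrivalRate`, exponential
service attempts at rate `serviceRate`, each attempt succeeding with probability `successProb`. -/
structure FeedbackQueue where
  arrivalRate : ℝ
  serviceRate : ℝ
  successProb : ℝ
  arrivalRate_pos : 0 < arrivalRate
  serviceRate_pos : 0 < serviceRate
  successProb_pos : 0 < successProb
  successProb_le_one : successProb ≤ 1

/-- Threshold strategy `𝒯(x)`: the probability of joining when the position upon joining
would be `i` (that is, when `i - 1` customers are present). -/
def joinProb (x : ℝ) (i : ℕ) : ℝ :=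
  if i ≤ ⌊x⌋₊ then 1 else if i = ⌊x⌋₊ + 1 then x - ⌊x⌋₊ else 0

namespace FeedbackQueue

/-- State of the system seen from a tagged customer: `some (i, j)` means that she is in position
`i` and that `j` customers (herself included) are present; `none` means that she has left. -/
abbrev State := Option (ℕ × ℕ)

/-- The random inputs of one transition of the uniformized chain: the holding time before the
transition, and three uniform variables on `[0, 1]` that decide, respectively, between an arrival
and a service completion, whether the completed service is successful, and whether the arriving
customer joins. -/
abbrev Input := ℝ × unitInterval × unitInterval × unitInterval

/-- One transition, when all customers other than the tagged one use the strategy `𝒯(x)`.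
An arriving customer who finds `j` customers joins in position `j + 1` with probability
`joinProb x (j + 1)`. After an unsuccessful service the customer goes to the end of the queue. -/
def step (Q : FeedbackQueue) (x : ℝ) (w : Input) : State → State
  | none => none
  | some (i, j) =>
    if (w.2.1 : ℝ) < Q.arrivalRate / (Q.arrivalRate + Q.serviceRate) then
      if (w.2.2.2 : ℝ) < joinProb x (j + 1) then some (i, j + 1) else some (i, j)
    else if (w.2.2.1 : ℝ) < Q.successProb then
      if i = 1 then none else some (i - 1, j - 1)
    else
      if i = 1 then some (j, j) else some (i - 1, j)

/-- The law of the inputs: independent transitions, each consisting of an exponential holding time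
of rate `arrivalRate + serviceRate` and three uniform variables, all independent. -/
def inputLaw (Q : FeedbackQueue) : Measure (ℕ → Input) :=
  Measure.infinitePi fun _ =>
    (expMeasure (Q.arrivalRate + Q.serviceRate)).prod
      ((volume : Measure unitInterval).prod
        ((volume : Measure unitInterval).prod (volume : Measure unitInterval)))

/-- The state after `n` transitions, starting from `some (i, j)`. -/
def state (Q : FeedbackQueue) (x : ℝ) (i j : ℕ) (ω : ℕ → Input) : ℕ → State
  | 0 => some (i, j)
  | n + 1 => Q.step x (ω n) (Q.state x i j ω n)

/-- The time `W_{i,j}^{(x)}` until the tagged customer leaves the system: the sum of the holding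
times spent before the chain is absorbed. -/
def sojournTime (Q : FeedbackQueue) (x : ℝ) (i j : ℕ) (ω : ℕ → Input) : ENNReal :=
  ∑' n, if Q.state x i j ω n = none then 0 else ENNReal.ofReal (ω n).1

/-- The discounted reward `e^{-αw}`, which is `0` if the reward is never received. -/
def discount (α : ℝ) (w : ENNReal) : ℝ :=
  if w = ⊤ then 0 else Real.exp (-α * w.toReal)

/-- The expected payoff `z_{i,j}^{(x)}(α) = 𝔼[e^{-α W_{i,j}^{(x)}}] - v`. -/
def payoff (Q : FeedbackQueue) (α v x : ℝ) (i j : ℕ) : ℝ :=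
  (∫ ω, discount α (Q.sojournTime x i j ω) ∂Q.inputLaw) - v

/-- `x` is a symmetric Nash equilibrium threshold: if all other customers use `𝒯(x)`, a tagged
customer cannot gain by deviating from `𝒯(x)`, whatever queue she finds on arrival. If she joins in
position `i` with probability `a`, and balks (payoff `0`) otherwise, her expected payoff is
`a * z_{i,i}^{(x)}(α)`. As the system starts empty, the numbers of customers that she may find are
`0, …, ⌈x⌉`, so that her position upon joining would be one of `1, …, ⌈x⌉ + 1`. -/
def IsNashThreshold (Q : FeedbackQueue) (α v x : ℝ) : Prop :=
  0 ≤ x ∧ ∀ i : ℕ, 1 ≤ i → i ≤ ⌈x⌉₊ + 1 → ∀ a ∈ Icc (0 : ℝ) 1,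
    a * Q.payoff α v x i i ≤ joinProb x i * Q.payoff α v x i i

end FeedbackQueue

end

/-! Conditioning on the first transition shows that the expected discounted reward is a solution,
with values in [0,1], of a Bellman equation with weights `a` (arrival) and `s` (service), where `a +
s = (λ+μ)/(λ+μ+α)` (`reward_first_step`). Everything else is deduced from this equation.

For `α > 0` the operator is a contraction. Value iteration from the constant 1 preserves the
inequalities of `QueueMono`, so the reward decreases in the number present and in the position
(`IsReward.queueMono`). The difference of the rewards for two thresholds solves the same equation
with a source proportional to the difference of the joining probabilities. A comparison principle
(`nonneg_of_bellman_le`) then gives monotonicity in the threshold (`IsReward.le_of_le`), strict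
where needed if `q < 1` (`IsReward.diagonal_lt_of_lt`), and Lipschitz continuity
(`IsReward.sub_le_of_abs_le`). For `α = 0` the sojourn is almost surely finite and all payoffs equal
`1 - v`.

An equilibrium requires payoff `≥ 0` at positions joined with positive probability and `≤ 0` at
positions not joined surely (`isNashThreshold_iff`). As payoffs decrease in the position, only the
positions around the threshold matter; monotonicity in the threshold gives uniqueness, and the
intermediate value theorem gives the fractional root. The bound `(μ/(μ+α))^i - v` makes payoffs
negative eventually, so that one of the cases must occur. -/

noncomputable section

/-! ### Shift invariance of the input law, and elementary integrals -/

/-- The sequence that starts with `a` and continues with `f`. -/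
def natCons {X : Type*} (a : X) (f : ℕ → X) : ℕ → X
  | 0 => a
  | n + 1 => f n

@[fun_prop]
theorem measurable_natCons {X : Type*} [MeasurableSpace X] :
    Measurable fun p : X × (ℕ → X) => natCons p.1 p.2 := by
  refine measurable_pi_iff.2 fun n => ?_
  cases n with
  | zero => exact measurable_fst
  | succ n => exact (measurable_pi_apply n).comp measurable_snd

/-- An infinite product measure is determined by finite boxes, and the preimage of a box splits into
a condition on the head and a box for the tail. This is the source of the Markov property at the
first transition. -/
theorem infinitePi_map_natCons {X : Type*} [MeasurableSpace X] (ν : Measure X)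
    [IsProbabilityMeasure ν] :
    (ν.prod (Measure.infinitePi fun _ : ℕ => ν)).map (fun p => natCons p.1 p.2) =
      Measure.infinitePi fun _ : ℕ => ν := by
  classical
  refine Measure.eq_infinitePi _ fun s t ht => ?_
  obtain ⟨n, hn⟩ := s.exists_nat_subset_range
  -- Padding with `univ` replaces `s` by an initial segment, from which coordinate 0 can be split
  -- off.
  let t' : ℕ → Set X := fun i => if i ∈ s then t i else univ
  have ht' : ∀ i, MeasurableSet (t' i) := fun i => by
    by_cases h : i ∈ s <;> simp [t', h, ht]
  have hprod : ∏ i ∈ s, ν (t i) = ∏ i ∈ Finset.range (n + 1), ν (t' i) := by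
    have hsub : s ⊆ Finset.range (n + 1) :=
      hn.trans (Finset.range_mono n.le_succ)
    rw [← Finset.prod_subset hsub (fun i _ hi => by simp [t', hi])]
    exact Finset.prod_congr rfl fun i hi => by simp [t', hi]
  have hset : (fun p : X × (ℕ → X) => natCons p.1 p.2) ⁻¹' (Set.pi s t) =
      t' 0 ×ˢ Set.pi (Finset.range n : Set ℕ) (fun i => t' (i + 1)) := by
    ext ⟨a, f⟩
    simp only [mem_preimage, Set.mem_pi, Finset.mem_coe, mem_prod, Finset.mem_range]
    constructor
    · intro h
      refine ⟨?_, fun i _ => ?_⟩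
      · by_cases h0 : 0 ∈ s
        · simpa [t', h0, natCons] using h 0 h0
        · simp [t', h0]
      · by_cases h0 : i + 1 ∈ s
        · simpa [t', h0, natCons] using h (i + 1) h0
        · simp [t', h0]
    · rintro ⟨h0, h1⟩ i hi
      cases i with
      | zero => simpa [t', hi, natCons] using h0
      | succ i =>
        have := h1 i (by have := Finset.mem_range.1 (hn hi); omega)
        simpa [t', hi, natCons] using this
  rw [Measure.map_apply measurable_natCons (.pi s.countable_toSet fun i _ => ht i), hset,
    Measure.prod_prod, Measure.infinitePi_pi _ (fun i _ => ht' _), hprod,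
    Finset.prod_range_succ', mul_comm]

theorem integral_exp_expMeasure {r α : ℝ} (hr : 0 < r) (hα : 0 ≤ α) :
    ∫ t, Real.exp (-α * max t 0) ∂(expMeasure r) = r / (r + α) := by
  have h1 : ∀ t : ℝ, (gammaPDF 1 r t).toReal • Real.exp (-α * max t 0) =
      (Ici (0 : ℝ)).indicator (fun t => r * Real.exp ((-(r + α)) * t)) t := by
    intro t
    by_cases ht : 0 ≤ t
    · have : gammaPDF 1 r t = exponentialPDF r t := rfl
      rw [this, exponentialPDF_of_nonneg ht, ENNReal.toReal_ofReal (by positivity),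
        indicator_of_mem (by exact ht), max_eq_left ht, smul_eq_mul, mul_assoc, ← Real.exp_add]
      ring_nf
    · rw [gammaPDF_of_neg (not_le.1 ht), indicator_of_notMem (by exact ht)]
      simp
  have hm : AEMeasurable (gammaPDF 1 r) :=
    (measurable_gammaPDFReal 1 r).ennreal_ofReal.aemeasurable
  rw [expMeasure, gammaMeasure, integral_withDensity_eq_integral_toReal_smul₀ hm
    (ae_of_all _ fun _ => ENNReal.ofReal_lt_top)]
  simp_rw [h1]
  rw [integral_indicator measurableSet_Ici, integral_Ici_eq_integral_Ioi, integral_const_mul,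
    integral_exp_mul_Ioi (by linarith)]
  rw [mul_zero, Real.exp_zero, neg_div_neg_eq, mul_one_div]

theorem integral_unitInterval_ite {p : ℝ} (h0 : 0 ≤ p) (h1 : p ≤ 1) (a b : ℝ) :
    ∫ u : unitInterval, (if (u : ℝ) < p then a else b) = p * a + (1 - p) * b := by
  have hm : MeasurableSet {u : unitInterval | (u : ℝ) < p} :=
    measurableSet_lt measurable_subtype_coe measurable_const
  have hv : (volume : Measure unitInterval).real {u : unitInterval | (u : ℝ) < p} = p := by
    have : {u : unitInterval | (u : ℝ) < p} = Iio ⟨p, h0, h1⟩ := rfl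
    rw [this, Measure.real, unitInterval.volume_Iio, ENNReal.toReal_ofReal h0]
  have hi : ∀ u : unitInterval, (if (u : ℝ) < p then a else b) =
      {u : unitInterval | (u : ℝ) < p}.indicator (fun _ => a - b) u + b := by
    intro u
    by_cases h : (u : ℝ) < p <;> simp [h]
  simp_rw [hi]
  rw [integral_add ((integrable_const _).indicator hm) (integrable_const _),
    integral_indicator_const _ hm, hv]
  simp
  ring

theorem integral_unitInterval_ite_ite {p q r : ℝ} (hp : p ∈ Icc (0 : ℝ) 1)
    (hq : q ∈ Icc (0 : ℝ) 1) (hr : r ∈ Icc (0 : ℝ) 1) (a b c d : ℝ) :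
    ∫ u : unitInterval × unitInterval × unitInterval,
      (if (u.1 : ℝ) < p then (if (u.2.2 : ℝ) < r then a else b)
        else if (u.2.1 : ℝ) < q then c else d) =
      p * (r * a + (1 - r) * b) + (1 - p) * (q * c + (1 - q) * d) := by
  have hi2 : ∀ u : unitInterval, Integrable (fun w : unitInterval × unitInterval =>
      (if (u : ℝ) < p then (if (w.2 : ℝ) < r then a else b)
        else if (w.1 : ℝ) < q then c else d)) := fun u => by
    refine Integrable.of_bound (C := |a| + |b| + |c| + |d|) (Measurable.aestronglyMeasurable ?_)
      (ae_of_all _ fun w => ?_)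
    · refine Measurable.ite (by measurability) (Measurable.ite ?_ (by fun_prop) (by fun_prop))
        (Measurable.ite ?_ (by fun_prop) (by fun_prop))
      · exact measurableSet_lt (by fun_prop) (by fun_prop)
      · exact measurableSet_lt (by fun_prop) (by fun_prop)
    · rw [Real.norm_eq_abs]
      have := abs_nonneg a
      have := abs_nonneg b
      have := abs_nonneg c
      have := abs_nonneg d
      split_ifs <;> linarith
  have hi3 : Integrable (fun u : unitInterval × unitInterval × unitInterval =>
      (if (u.1 : ℝ) < p then (if (u.2.2 : ℝ) < r then a else b)
        else if (u.2.1 : ℝ) < q then c else d)) := by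
    refine Integrable.of_bound (C := |a| + |b| + |c| + |d|) (Measurable.aestronglyMeasurable ?_)
      (ae_of_all _ fun w => ?_)
    · refine Measurable.ite ?_ (Measurable.ite ?_ (by fun_prop) (by fun_prop))
        (Measurable.ite ?_ (by fun_prop) (by fun_prop))
      all_goals exact measurableSet_lt (by fun_prop) (by fun_prop)
    · rw [Real.norm_eq_abs]
      have := abs_nonneg a
      have := abs_nonneg b
      have := abs_nonneg c
      have := abs_nonneg d
      split_ifs <;> linarith
  rw [Measure.volume_eq_prod, integral_prod _ hi3]
  have : ∀ u : unitInterval, (∫ w : unitInterval × unitInterval,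
      (if (u : ℝ) < p then (if (w.2 : ℝ) < r then a else b)
        else if (w.1 : ℝ) < q then c else d)) =
      if (u : ℝ) < p then r * a + (1 - r) * b else q * c + (1 - q) * d := by
    intro u
    rw [Measure.volume_eq_prod, integral_prod _ (hi2 u)]
    split_ifs with h
    · simp only [integral_unitInterval_ite hr.1 hr.2]
      simp
    · have hc : ∀ s : unitInterval, (∫ _ : unitInterval, (if (s : ℝ) < q then c else d)) =
          if (s : ℝ) < q then c else d := fun s => by simp
      exact (integral_congr_ae (ae_of_all _ hc)).trans (integral_unitInterval_ite hq.1 hq.2 c d)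
  simp_rw [this]
  exact integral_unitInterval_ite hp.1 hp.2 _ _

/-! ### The chain from an arbitrary state and its Markov property -/

namespace FeedbackQueue

/-- The state after `n` transitions, starting from an arbitrary state. -/
def stateFrom (Q : FeedbackQueue) (x : ℝ) (s : State) (ω : ℕ → Input) : ℕ → State
  | 0 => s
  | n + 1 => Q.step x (ω n) (Q.stateFrom x s ω n)

/-- The time until absorption, starting from an arbitrary state. -/
def timeFrom (Q : FeedbackQueue) (x : ℝ) (s : State) (ω : ℕ → Input) : ENNReal :=
  ∑' n, if Q.stateFrom x s ω n = none then 0 else ENNReal.ofReal (ω n).1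

/-- The expected discounted reward, starting from an arbitrary state. -/
def rewardFrom (Q : FeedbackQueue) (α x : ℝ) (s : State) : ℝ :=
  ∫ ω, discount α (Q.timeFrom x s ω) ∂Q.inputLaw

/-- The expected discounted reward `𝔼[e^{-α W_{i,j}^{(x)}}]`. -/
def reward (Q : FeedbackQueue) (α x : ℝ) (i j : ℕ) : ℝ :=
  Q.rewardFrom α x (some (i, j))

variable (Q : FeedbackQueue) (α v x : ℝ)

theorem state_eq_stateFrom (i j : ℕ) (ω : ℕ → Input) (n : ℕ) :
    Q.state x i j ω n = Q.stateFrom x (some (i, j)) ω n := by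
  induction n with
  | zero => rfl
  | succ n ih => rw [state, stateFrom, ih]

theorem payoff_eq (i j : ℕ) : Q.payoff α v x i j = Q.reward α x i j - v := by
  simp only [payoff, reward, rewardFrom, sojournTime, timeFrom, state_eq_stateFrom]

theorem stateFrom_natCons (s : State) (w : Input) (ω : ℕ → Input) (n : ℕ) :
    Q.stateFrom x s (natCons w ω) (n + 1) = Q.stateFrom x (Q.step x w s) ω n := by
  induction n with
  | zero => rfl
  | succ n ih => rw [stateFrom, ih]; rfl

theorem stateFrom_none (ω : ℕ → Input) (n : ℕ) : Q.stateFrom x none ω n = none := by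
  induction n with
  | zero => rfl
  | succ n ih => rw [stateFrom, ih]; rfl

theorem rewardFrom_none [IsProbabilityMeasure Q.inputLaw] : Q.rewardFrom α x none = 1 := by
  simp [rewardFrom, timeFrom, stateFrom_none, discount]

theorem timeFrom_natCons (p : ℕ × ℕ) (w : Input) (ω : ℕ → Input) :
    Q.timeFrom x (some p) (natCons w ω) =
      ENNReal.ofReal w.1 + Q.timeFrom x (Q.step x w (some p)) ω := by
  rw [timeFrom, tsum_eq_zero_add' ENNReal.summable, timeFrom]
  simp only [stateFrom_natCons]
  simp [stateFrom, natCons]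

/-- The truncation `max t 0` mirrors `ENNReal.ofReal`, so no sign condition on the holding time is
needed. Both sides vanish when `W = ⊤`. -/
theorem discount_ofReal_add {α : ℝ} (t : ℝ) (W : ENNReal) :
    discount α (ENNReal.ofReal t + W) = Real.exp (-α * max t 0) * discount α W := by
  by_cases hW : W = ⊤
  · simp [discount, hW]
  · have : ENNReal.ofReal t + W ≠ ⊤ := by simp [hW]
    rw [discount, discount, if_neg this, if_neg hW, ← Real.exp_add,
      ENNReal.toReal_add ENNReal.ofReal_ne_top hW, ENNReal.toReal_ofReal']
    ring_nf

theorem discount_nonneg (w : ENNReal) : 0 ≤ discount α w := by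
  unfold discount
  split_ifs <;> positivity

theorem discount_le_one {α : ℝ} (hα : 0 ≤ α) (w : ENNReal) : discount α w ≤ 1 := by
  unfold discount
  split_ifs
  · simp
  · rw [Real.exp_le_one_iff]
    nlinarith [ENNReal.toReal_nonneg (a := w)]

@[fun_prop]
theorem measurable_discount : Measurable (discount α) := by
  unfold discount
  exact Measurable.ite (measurableSet_singleton _) measurable_const (by fun_prop)

theorem measurableSet_step (s s' : State) : MeasurableSet {w : Input | Q.step x w s = s'} := by
  cases s with
  | none => by_cases h : none = s' <;> simp [step, h]
  | some p =>
    obtain ⟨i, j⟩ := p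
    simp only [step]
    have h : ∀ (A : Set Input) (c d : Input → State), MeasurableSet A →
        MeasurableSet {w | c w = s'} → MeasurableSet {w | d w = s'} →
        ∀ [DecidablePred (· ∈ A)], MeasurableSet {w | (if w ∈ A then c w else d w) = s'} := by
      intro A c d hA hc hd _
      have : {w | (if w ∈ A then c w else d w) = s'} =
          (A ∩ {w | c w = s'}) ∪ (Aᶜ ∩ {w | d w = s'}) := by
        ext w
        by_cases hw : w ∈ A <;> simp [hw]
      rw [this]
      exact (hA.inter hc).union (hA.compl.inter hd)
    have hconst : ∀ c : State, MeasurableSet {_w : Input | c = s'} := fun c =>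
      MeasurableSet.const _
    refine h {w | (w.2.1 : ℝ) < _} _ _ (measurableSet_lt (by fun_prop) (by fun_prop)) ?_ ?_
    · exact h {w | (w.2.2.2 : ℝ) < _} _ _ (measurableSet_lt (by fun_prop) (by fun_prop))
        (hconst _) (hconst _)
    · exact h {w | (w.2.2.1 : ℝ) < _} _ _ (measurableSet_lt (by fun_prop) (by fun_prop))
        (hconst _) (hconst _)

theorem measurableSet_stateFrom (s s' : State) (n : ℕ) :
    MeasurableSet {ω | Q.stateFrom x s ω n = s'} := by
  induction n generalizing s' with
  | zero => exact MeasurableSet.const (s = s')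
  | succ n ih =>
    -- There are countably many states, so one may condition on the previous one.
    have : {ω | Q.stateFrom x s ω (n + 1) = s'} = ⋃ r : State,
        {ω | Q.stateFrom x s ω n = r} ∩ (fun ω => ω n) ⁻¹' {w : Input | Q.step x w r = s'} := by
      ext ω
      simp [stateFrom]
    rw [this]
    exact MeasurableSet.iUnion fun r =>
      (ih r).inter ((measurable_pi_apply n) (Q.measurableSet_step x r s'))

@[fun_prop]
theorem measurable_timeFrom (s : State) : Measurable (Q.timeFrom x s) := by
  unfold timeFrom
  refine Measurable.tsum fun n => ?_
  exact Measurable.ite (Q.measurableSet_stateFrom x s none n) measurable_const (by fun_prop)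

/-- The law of the inputs of one transition. -/
def stepLaw : Measure Input :=
  (expMeasure (Q.arrivalRate + Q.serviceRate)).prod
    ((volume : Measure unitInterval).prod
      ((volume : Measure unitInterval).prod (volume : Measure unitInterval)))

theorem rate_pos : 0 < Q.arrivalRate + Q.serviceRate :=
  add_pos Q.arrivalRate_pos Q.serviceRate_pos

instance : IsProbabilityMeasure (expMeasure (Q.arrivalRate + Q.serviceRate)) :=
  isProbabilityMeasure_expMeasure Q.rate_pos

instance : IsProbabilityMeasure Q.stepLaw := by
  unfold stepLaw
  infer_instance

theorem inputLaw_eq : Q.inputLaw = Measure.infinitePi fun _ => Q.stepLaw := rfl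

instance : IsProbabilityMeasure Q.inputLaw := by
  rw [inputLaw_eq]
  infer_instance

theorem integrable_discount {α : ℝ} (hα : 0 ≤ α) (s : State) :
    Integrable (fun ω => discount α (Q.timeFrom x s ω)) Q.inputLaw := by
  refine Integrable.of_bound (C := 1) (Measurable.aestronglyMeasurable (by fun_prop))
    (ae_of_all _ fun ω => ?_)
  rw [Real.norm_eq_abs, abs_of_nonneg (discount_nonneg _ _)]
  exact discount_le_one hα _

theorem rewardFrom_nonneg (s : State) : 0 ≤ Q.rewardFrom α x s :=
  integral_nonneg fun _ => discount_nonneg _ _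

theorem rewardFrom_le_one {α : ℝ} (hα : 0 ≤ α) (s : State) : Q.rewardFrom α x s ≤ 1 := by
  have := integral_mono (Q.integrable_discount x hα s) (integrable_const 1)
    fun ω => discount_le_one hα (Q.timeFrom x s ω)
  simpa [rewardFrom] using this

theorem rewardFrom_some {α : ℝ} (hα : 0 ≤ α) (p : ℕ × ℕ) :
    Q.rewardFrom α x (some p) =
      ∫ w, Real.exp (-α * max w.1 0) * Q.rewardFrom α x (Q.step x w (some p)) ∂Q.stepLaw := by
  have hmap := infinitePi_map_natCons Q.stepLaw
  rw [← inputLaw_eq] at hmap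
  have hmeas : Measurable fun ω => discount α (Q.timeFrom x (some p) ω) := by fun_prop
  have hint := Q.integrable_discount x hα (some p)
  rw [← hmap] at hint
  rw [rewardFrom]
  conv_lhs => rw [← hmap]
  rw [integral_map measurable_natCons.aemeasurable hmeas.aestronglyMeasurable,
    integral_prod (fun z => discount α (Q.timeFrom x (some p) (natCons z.1 z.2)))
      (hint.comp_measurable measurable_natCons)]
  simp only [timeFrom_natCons, discount_ofReal_add, integral_const_mul]
  rfl

/-- The new state does not depend on the holding time (hence the dummy 0), so the discount factor of
the first holding time splits off by independence. -/
theorem reward_eq_integral {α : ℝ} (hα : 0 ≤ α) (p : ℕ × ℕ) :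
    Q.rewardFrom α x (some p) =
      (Q.arrivalRate + Q.serviceRate) / (Q.arrivalRate + Q.serviceRate + α) *
      ∫ u : unitInterval × unitInterval × unitInterval,
        Q.rewardFrom α x (Q.step x (0, u) (some p)) := by
  rw [Q.rewardFrom_some x hα, ← integral_exp_expMeasure Q.rate_pos hα]
  exact integral_prod_mul (fun t : ℝ => Real.exp (-α * max t 0))
    (fun u => Q.rewardFrom α x (Q.step x (0, u) (some p)))

end FeedbackQueue

/-- As a clamped affine function, the joining probability is visibly monotone and 1-Lipschitz in
`x`. -/
theorem joinProb_eq {x : ℝ} (hx : 0 ≤ x) (i : ℕ) :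
    joinProb x i = max 0 (min 1 (x - i + 1)) := by
  have h1 := Nat.floor_le hx
  have h2 := Nat.lt_floor_add_one x
  unfold joinProb
  split_ifs with h h'
  · have : (i : ℝ) ≤ ⌊x⌋₊ := by exact_mod_cast h
    rw [min_eq_left (by linarith), max_eq_right zero_le_one]
  · subst h'
    push_cast
    rw [min_eq_right (by linarith), max_eq_right (by linarith)]
    ring
  · have : (⌊x⌋₊ : ℝ) + 2 ≤ i := by
      have : ⌊x⌋₊ + 2 ≤ i := by omega
      exact_mod_cast this
    rw [min_eq_right (by linarith), max_eq_left (by linarith)]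

theorem joinProb_mem_Icc {x : ℝ} (hx : 0 ≤ x) (i : ℕ) : joinProb x i ∈ Icc (0 : ℝ) 1 := by
  rw [joinProb_eq hx]
  exact ⟨le_max_left _ _, max_le zero_le_one (min_le_left _ _)⟩

/-! ### First-step equations -/

namespace FeedbackQueue

theorem reward_first_step (Q : FeedbackQueue) {α x : ℝ} (hα : 0 ≤ α) (hx : 0 ≤ x) (i j : ℕ) :
    Q.reward α x i j =
      Q.arrivalRate / (Q.arrivalRate + Q.serviceRate + α) *
        (joinProb x (j + 1) * Q.reward α x i (j + 1) +
          (1 - joinProb x (j + 1)) * Q.reward α x i j) +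
      Q.serviceRate / (Q.arrivalRate + Q.serviceRate + α) *
        (Q.successProb * (if i = 1 then 1 else Q.reward α x (i - 1) (j - 1)) +
          (1 - Q.successProb) *
            (if i = 1 then Q.reward α x j j else Q.reward α x (i - 1) j)) := by
  have hr := Q.rate_pos
  have hstep : ∀ u : unitInterval × unitInterval × unitInterval,
      Q.rewardFrom α x (Q.step x (0, u) (some (i, j))) =
      if (u.1 : ℝ) < Q.arrivalRate / (Q.arrivalRate + Q.serviceRate) then
        (if (u.2.2 : ℝ) < joinProb x (j + 1) then Q.reward α x i (j + 1) else Q.reward α x i j)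
      else if (u.2.1 : ℝ) < Q.successProb then
        (if i = 1 then 1 else Q.reward α x (i - 1) (j - 1))
      else (if i = 1 then Q.reward α x j j else Q.reward α x (i - 1) j) := by
    intro u
    simp only [step, reward]
    split_ifs <;> first | rfl | exact Q.rewardFrom_none α x
  have hp : Q.arrivalRate / (Q.arrivalRate + Q.serviceRate) ∈ Icc (0 : ℝ) 1 :=
    ⟨div_nonneg Q.arrivalRate_pos.le hr.le,
      (div_le_one hr).2 (by linarith [Q.serviceRate_pos])⟩
  conv_lhs => rw [reward, Q.reward_eq_integral x hα]
  simp_rw [hstep]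
  rw [integral_unitInterval_ite_ite hp ⟨Q.successProb_pos.le, Q.successProb_le_one⟩
    (joinProb_mem_Icc hx _)]
  have : Q.arrivalRate + Q.serviceRate + α ≠ 0 := by positivity
  field_simp
  ring

end FeedbackQueue

/-! ### The Bellman operator, abstractly, and its comparison principle -/

section Bellman

/-- The one-step operator of the tagged customer's chain: weight `a` for an arrival, who joins with
probability `u j` when `j` customers are present, weight `s` for a service, which succeeds with
probability `q`, and terminal reward `c`. -/
def bellman (a s q : ℝ) (u : ℕ → ℝ) (c : ℝ) (f : ℕ → ℕ → ℝ) (i j : ℕ) : ℝ :=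
  a * (u j * f i (j + 1) + (1 - u j) * f i j) +
    s * (q * (if i = 1 then c else f (i - 1) (j - 1)) +
      (1 - q) * (if i = 1 then f j j else f (i - 1) j))

/-- Admissible weights and joining probabilities for `bellman`. -/
structure BellmanData (a s q : ℝ) (u : ℕ → ℝ) : Prop where
  a_pos : 0 < a
  s_pos : 0 < s
  add_le : a + s ≤ 1
  q_pos : 0 < q
  q_le : q ≤ 1
  u_nonneg : ∀ j, 0 ≤ u j
  u_le : ∀ j, u j ≤ 1
  u_anti : ∀ j, u (j + 1) ≤ u j

/-- A bounded solution of the first-step equations. -/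
structure IsReward (a s q : ℝ) (u : ℕ → ℝ) (f : ℕ → ℕ → ℝ) : Prop where
  nonneg : ∀ i j, 0 ≤ f i j
  le_one : ∀ i j, f i j ≤ 1
  eq : ∀ i j, f i j = bellman a s q u 1 f i j

/-- Monotonicity in the number of customers and in the position, and the comparison of the first
two positions at the next service. -/
structure QueueMono (q : ℝ) (f : ℕ → ℕ → ℝ) : Prop where
  number : ∀ i j, 1 ≤ i → i ≤ j → f i (j + 1) ≤ f i j
  position : ∀ i j, 1 ≤ i → i + 1 ≤ j → f (i + 1) j ≤ f i j
  service : ∀ j, 1 ≤ j → q * f 1 j + (1 - q) * f 1 (j + 1) ≤ q + (1 - q) * f (j + 1) (j + 1)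

variable {a s q : ℝ} {u u' : ℕ → ℝ} {f g : ℕ → ℕ → ℝ}

theorem bellman_one (c : ℝ) (f : ℕ → ℕ → ℝ) (j : ℕ) : bellman a s q u c f 1 j =
    a * (u j * f 1 (j + 1) + (1 - u j) * f 1 j) + s * (q * c + (1 - q) * f j j) := by
  simp [bellman]

theorem bellman_succ {i : ℕ} (hi : 1 ≤ i) (c : ℝ) (f : ℕ → ℕ → ℝ) (j : ℕ) :
    bellman a s q u c f (i + 1) (j + 1) =
    a * (u (j + 1) * f (i + 1) (j + 2) + (1 - u (j + 1)) * f (i + 1) (j + 1)) +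
      s * (q * f i j + (1 - q) * f i (j + 1)) := by
  simp [bellman, show i ≠ 0 by omega]

theorem bellman_sub (c c' : ℝ) (f g : ℕ → ℕ → ℝ) (i j : ℕ) :
    bellman a s q u (c - c') (fun i j => f i j - g i j) i j =
      bellman a s q u c f i j - bellman a s q u c' g i j := by
  unfold bellman
  split_ifs <;> ring

theorem bellman_const (c : ℝ) (i j : ℕ) :
    bellman a s q u c (fun _ _ => c) i j = (a + s) * c := by
  unfold bellman
  split_ifs <;> ring

theorem bellman_mono (h : BellmanData a s q u) {c c' : ℝ} (hc : c ≤ c')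
    (hfg : ∀ i j, 1 ≤ i → i ≤ j → f i j ≤ g i j) {i j : ℕ} (hi : 1 ≤ i) (hij : i ≤ j) :
    bellman a s q u c f i j ≤ bellman a s q u c' g i j := by
  have ha := h.a_pos.le
  have hs := h.s_pos.le
  have hq := h.q_pos.le
  have hq' : 0 ≤ 1 - q := by linarith [h.q_le]
  have hu := h.u_nonneg j
  have hu' : 0 ≤ 1 - u j := by linarith [h.u_le j]
  have h1 := hfg i (j + 1) hi (by omega)
  have h2 := hfg i j hi hij
  unfold bellman
  split_ifs with hi1
  · have h3 := hfg j j (by omega) le_rfl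
    gcongr
  · have h3 := hfg (i - 1) (j - 1) (by omega) (by omega)
    have h4 := hfg (i - 1) j (by omega) (by omega)
    gcongr

/-- Comparison principle: each application of the operator shrinks the lower bound `-M` by the
factor `a + s < 1`. Only states with `1 ≤ i ≤ j` enter, and the operator does not leave them. -/
theorem nonneg_of_bellman_le (h : BellmanData a s q u) (hlt : a + s < 1) {d : ℕ → ℕ → ℝ} {M : ℝ}
    (hM : 0 ≤ M) (hd : ∀ i j, 1 ≤ i → i ≤ j → -M ≤ d i j)
    (hle : ∀ i j, 1 ≤ i → i ≤ j → bellman a s q u 0 d i j ≤ d i j) {i j : ℕ} (hi : 1 ≤ i)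
    (hij : i ≤ j) : 0 ≤ d i j := by
  have h0 : 0 ≤ a + s := add_nonneg h.a_pos.le h.s_pos.le
  have key : ∀ n : ℕ, ∀ i j, 1 ≤ i → i ≤ j → -(M * (a + s) ^ n) ≤ d i j := by
    intro n
    induction n with
    | zero => simpa using hd
    | succ n ih =>
      intro i j hi hij
      refine le_trans ?_ (hle i j hi hij)
      have := bellman_mono h (c := -(M * (a + s) ^ n)) (c' := 0)
        (by have : 0 ≤ M * (a + s) ^ n := by positivity
            linarith) ih hi hij
      rw [bellman_const] at this
      refine le_trans (le_of_eq ?_) this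
      ring
  have ht : Filter.Tendsto (fun n : ℕ => -(M * (a + s) ^ n)) Filter.atTop (nhds (-(M * 0))) :=
    ((tendsto_pow_atTop_nhds_zero_of_lt_one h0 hlt).const_mul M).neg
  have := le_of_tendsto' ht fun n => key n i j hi hij
  simpa using this

theorem IsReward.abs_sub_le (hf : IsReward a s q u f) (hg : IsReward a s q u' g) (i j : ℕ) :
    |f i j - g i j| ≤ 1 := by
  rw [abs_le]
  constructor <;> linarith [hf.nonneg i j, hf.le_one i j, hg.nonneg i j, hg.le_one i j]

/-! ### Monotonicity -/

theorem QueueMono.diagonal (hf : QueueMono q f) {i : ℕ} (hi : 1 ≤ i) :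
    f (i + 1) (i + 1) ≤ f i i :=
  (hf.position i (i + 1) hi le_rfl).trans (hf.number i i hi le_rfl)

/-- At a service completion the first customer may fall behind the second, so the comparison is not
termwise. In the expansion the terms in `f j j` cancel; the decreasing joining probabilities absorb
the mismatch between `u j` and `u (j + 1)`. The slack `q * (1 - (a + s))` is the source of all
strict inequalities later. -/
theorem bellman_service (h : BellmanData a s q u) (hf : QueueMono q f) {j : ℕ} (hj : 1 ≤ j) :
    q * (1 - (a + s)) ≤ q + (1 - q) * bellman a s q u 1 f (j + 1) (j + 1) -
      (q * bellman a s q u 1 f 1 j + (1 - q) * bellman a s q u 1 f 1 (j + 1)) := by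
  rw [bellman_one, bellman_one, bellman_succ hj]
  have hq' : 0 ≤ 1 - q := by linarith [h.q_le]
  have e1 : 0 ≤ q + (1 - q) * f (j + 1) (j + 2) - (q * f 1 (j + 1) + (1 - q) * f 1 (j + 2)) := by
    have := mul_le_mul_of_nonneg_left (hf.position (j + 1) (j + 2) (by omega) le_rfl) hq'
    linarith [hf.service (j + 1) (by omega)]
  have e2 : 0 ≤ q + (1 - q) * f (j + 1) (j + 1) - (q * f 1 j + (1 - q) * f 1 (j + 1)) := by
    linarith [hf.service j hj]
  have t1 := mul_nonneg (mul_nonneg h.a_pos.le (h.u_nonneg (j + 1))) e1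
  have t2 := mul_nonneg (mul_nonneg h.a_pos.le (sub_nonneg.2 (h.u_le (j + 1)))) e2
  have t3 := mul_nonneg (mul_nonneg (mul_nonneg h.a_pos.le h.q_pos.le)
    (sub_nonneg.2 (h.u_anti j))) (sub_nonneg.2 (hf.number 1 j le_rfl hj))
  have t4 := mul_nonneg (mul_nonneg h.s_pos.le (mul_nonneg hq' hq'))
    (sub_nonneg.2 (hf.position j (j + 1) hj le_rfl))
  linarith

theorem bellman_number_one (h : BellmanData a s q u) (hf : QueueMono q f) {j : ℕ} (hj : 1 ≤ j) :
    s * ((1 - q) * (f j j - f (j + 1) (j + 1))) ≤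
      bellman a s q u 1 f 1 j - bellman a s q u 1 f 1 (j + 1) := by
  rw [bellman_one, bellman_one]
  have t1 := mul_nonneg (mul_nonneg h.a_pos.le (sub_nonneg.2 (h.u_le j)))
    (sub_nonneg.2 (hf.number 1 j le_rfl hj))
  have t2 := mul_nonneg (mul_nonneg h.a_pos.le (h.u_nonneg (j + 1)))
    (sub_nonneg.2 (hf.number 1 (j + 1) le_rfl (by omega)))
  linarith

theorem bellman_number_succ (h : BellmanData a s q u) (hf : QueueMono q f) {i j : ℕ} (hi : 1 ≤ i)
    (hij : i ≤ j) : s * ((1 - q) * (f i (j + 1) - f i (j + 2))) ≤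
      bellman a s q u 1 f (i + 1) (j + 1) - bellman a s q u 1 f (i + 1) (j + 2) := by
  rw [bellman_succ hi, bellman_succ hi]
  have t1 := mul_nonneg (mul_nonneg h.a_pos.le (sub_nonneg.2 (h.u_le (j + 1))))
    (sub_nonneg.2 (hf.number (i + 1) (j + 1) (by omega) (by omega)))
  have t2 := mul_nonneg (mul_nonneg h.a_pos.le (h.u_nonneg (j + 2)))
    (sub_nonneg.2 (hf.number (i + 1) (j + 2) (by omega) (by omega)))
  have t3 := mul_nonneg (mul_nonneg h.s_pos.le h.q_pos.le) (sub_nonneg.2 (hf.number i j hi hij))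
  linarith

theorem bellman_arrival_position (h : BellmanData a s q u) (hf : QueueMono q f) {i j : ℕ}
    (hi : 1 ≤ i) (hij : i + 1 ≤ j) :
    a * (u j * f (i + 1) (j + 1) + (1 - u j) * f (i + 1) j) ≤
      a * (u j * f i (j + 1) + (1 - u j) * f i j) := by
  have ha := h.a_pos.le
  have hu := h.u_nonneg j
  have hu' := sub_nonneg.2 (h.u_le j)
  have h1 := hf.position i (j + 1) hi (by omega)
  have h2 := hf.position i j hi hij
  gcongr

theorem bellman_position_one (h : BellmanData a s q u) (hf : QueueMono q f) {j : ℕ} (hj : 1 ≤ j) :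
    s * (q + (1 - q) * f (j + 1) (j + 1) - (q * f 1 j + (1 - q) * f 1 (j + 1))) ≤
      bellman a s q u 1 f 1 (j + 1) - bellman a s q u 1 f 2 (j + 1) := by
  have := bellman_arrival_position h hf (i := 1) (j := j + 1) le_rfl (by omega)
  rw [bellman_one, bellman_succ le_rfl]
  linarith

theorem bellman_position_succ (h : BellmanData a s q u) (hf : QueueMono q f) {i j : ℕ} (hi : 1 ≤ i)
    (hij : i + 1 ≤ j) : s * (q * (f i j - f (i + 1) j)) ≤
      bellman a s q u 1 f (i + 1) (j + 1) - bellman a s q u 1 f (i + 2) (j + 1) := by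
  have := bellman_arrival_position h hf (i := i + 1) (j := j + 1) (by omega) (by omega)
  rw [bellman_succ hi, bellman_succ (by omega : 1 ≤ i + 1)]
  have t1 := mul_nonneg (mul_nonneg h.s_pos.le (sub_nonneg.2 h.q_le))
    (sub_nonneg.2 (hf.position i (j + 1) hi (by omega)))
  linarith

theorem QueueMono.bellman (h : BellmanData a s q u) (hf : QueueMono q f) :
    QueueMono q (bellman a s q u 1 f) := by
  have hs := h.s_pos.le
  have hq := h.q_pos.le
  have hq' := sub_nonneg.2 h.q_le
  refine ⟨fun i j hi hij => ?_, fun i j hi hij => ?_, fun j hj => ?_⟩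
  · obtain ⟨j, rfl⟩ : ∃ k, j = k + 1 := ⟨j - 1, by omega⟩
    obtain ⟨i, rfl⟩ : ∃ k, i = k + 1 := ⟨i - 1, by omega⟩
    rcases Nat.eq_zero_or_pos i with rfl | hi'
    · have h1 := bellman_number_one h hf hij
      have h2 := mul_nonneg hs (mul_nonneg hq' (sub_nonneg.2 (hf.diagonal hij)))
      simp only [zero_add] at *
      linarith
    · have h1 := bellman_number_succ h hf hi' (show i ≤ j by omega)
      have h2 := mul_nonneg hs (mul_nonneg hq'
        (sub_nonneg.2 (hf.number i (j + 1) hi' (by omega))))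
      simp only [add_assoc] at *
      linarith
  · obtain ⟨j, rfl⟩ : ∃ k, j = k + 1 := ⟨j - 1, by omega⟩
    obtain ⟨i, rfl⟩ : ∃ k, i = k + 1 := ⟨i - 1, by omega⟩
    rcases Nat.eq_zero_or_pos i with rfl | hi'
    · have h1 := bellman_position_one h hf (show 1 ≤ j by omega)
      have h2 := mul_nonneg hs (sub_nonneg.2 (hf.service j (by omega)))
      simp only [zero_add] at *
      norm_num at *
      linarith
    · have h1 := bellman_position_succ h hf hi' (show i + 1 ≤ j by omega)
      have h2 := mul_nonneg hs (mul_nonneg hq (sub_nonneg.2 (hf.position i j hi' (by omega))))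
      simp only [add_assoc] at *
      norm_num at *
      linarith
  · have h1 := bellman_service h hf hj
    have h2 := mul_nonneg hq (sub_nonneg.2 h.add_le)
    linarith

theorem IsReward.queueMono (h : BellmanData a s q u) (hlt : a + s < 1)
    (hf : IsReward a s q u f) : QueueMono q f := by
  have h0 : 0 ≤ a + s := add_nonneg h.a_pos.le h.s_pos.le
  -- Value iteration from the constant 1, which satisfies `QueueMono` trivially; the iterates
  -- converge geometrically to `f` from above.
  let F : ℕ → ℕ → ℕ → ℝ := fun n => (_root_.bellman a s q u 1)^[n] (fun _ _ => 1)
  have hF : ∀ n, F (n + 1) = _root_.bellman a s q u 1 (F n) := fun n =>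
    Function.iterate_succ_apply' _ _ _
  have hmono : ∀ n, QueueMono q (F n) := by
    intro n
    induction n with
    | zero => exact ⟨by simp [F], by simp [F], by simp [F]⟩
    | succ n ih =>
      rw [hF]
      exact ih.bellman h
  have hdist : ∀ n i j, 1 ≤ i → i ≤ j → 0 ≤ F n i j - f i j ∧ F n i j - f i j ≤ (a + s) ^ n := by
    intro n
    induction n with
    | zero =>
      intro i j _ _
      have h1 := hf.nonneg i j
      have h2 := hf.le_one i j
      simp only [F, Function.iterate_zero, id, pow_zero]
      constructor <;> linarith
    | succ n ih =>
      intro i j hi hij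
      rw [hF, hf.eq i j, ← bellman_sub, sub_self]
      have hn : (0 : ℝ) ≤ (a + s) ^ n := by positivity
      have h1 := bellman_mono h (f := fun _ _ => 0) (le_refl (0 : ℝ)) (fun i j hi hij => (ih i j hi hij).1)
        hi hij
      have h2 := bellman_mono h (g := fun _ _ => (a + s) ^ n) hn
        (fun i j hi hij => (ih i j hi hij).2) hi hij
      rw [bellman_const] at h1 h2
      rw [pow_succ']
      exact ⟨by linarith, h2⟩
  have htend : ∀ i j, 1 ≤ i → i ≤ j →
      Filter.Tendsto (fun n => F n i j) Filter.atTop (nhds (f i j)) := by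
    intro i j hi hij
    have : Filter.Tendsto (fun n => F n i j - f i j) Filter.atTop (nhds 0) :=
      squeeze_zero (fun n => (hdist n i j hi hij).1) (fun n => (hdist n i j hi hij).2)
        (tendsto_pow_atTop_nhds_zero_of_lt_one h0 hlt)
    simpa using this.add_const (f i j)
  refine ⟨fun i j hi hij => ?_, fun i j hi hij => ?_, fun j hj => ?_⟩
  · exact le_of_tendsto_of_tendsto' (htend i (j + 1) hi (by omega)) (htend i j hi hij)
      fun n => (hmono n).number i j hi hij
  · exact le_of_tendsto_of_tendsto' (htend (i + 1) j (by omega) hij) (htend i j hi (by omega))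
      fun n => (hmono n).position i j hi hij
  · exact le_of_tendsto_of_tendsto'
      (((htend 1 j le_rfl hj).const_mul q).add
        ((htend 1 (j + 1) le_rfl (by omega)).const_mul (1 - q)))
      (((htend (j + 1) (j + 1) (by omega) le_rfl).const_mul (1 - q)).const_add q)
      fun n => (hmono n).service j hj

/-- Strictness starts at position 1 with the slack in `bellman_service` and passes to later
positions through successful services. -/
theorem IsReward.position_lt (h : BellmanData a s q u) (hlt : a + s < 1)
    (hf : IsReward a s q u f) {i : ℕ} (hi : 1 ≤ i) :
    ∀ j, i + 1 ≤ j → f (i + 1) j < f i j := by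
  have hm := hf.queueMono h hlt
  induction i, hi using Nat.le_induction with
  | base =>
    intro j hj
    obtain ⟨j, rfl⟩ : ∃ k, j = k + 1 := ⟨j - 1, by omega⟩
    have h1 := bellman_position_one h hm (show 1 ≤ j by omega)
    have h2 := bellman_service h hm (show 1 ≤ j by omega)
    simp only [← hf.eq] at h1 h2
    have h3 := mul_pos h.s_pos ((mul_pos h.q_pos (sub_pos.2 hlt)).trans_le h2)
    norm_num
    linarith
  | succ i hi ih =>
    intro j hj
    obtain ⟨j, rfl⟩ : ∃ k, j = k + 1 := ⟨j - 1, by omega⟩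
    have h1 := bellman_position_succ h hm hi (show i + 1 ≤ j by omega)
    have h2 := mul_pos h.s_pos (mul_pos h.q_pos (sub_pos.2 (ih j (by omega))))
    simp only [← hf.eq] at h1
    simp only [add_assoc] at *
    norm_num at *
    linarith

theorem IsReward.diagonal_lt (h : BellmanData a s q u) (hlt : a + s < 1)
    (hf : IsReward a s q u f) {i : ℕ} (hi : 1 ≤ i) : f (i + 1) (i + 1) < f i i :=
  (hf.position_lt h hlt hi _ le_rfl).trans_le ((hf.queueMono h hlt).number i i hi le_rfl)

/-- Customers behind the tagged one hurt her only when a failed attempt sends her to the end, whence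
`q < 1`. -/
theorem IsReward.number_lt (h : BellmanData a s q u) (hlt : a + s < 1) (hq : q < 1)
    (hf : IsReward a s q u f) {i : ℕ} (hi : 1 ≤ i) : ∀ j, i ≤ j → f i (j + 1) < f i j := by
  have hm := hf.queueMono h hlt
  induction i, hi using Nat.le_induction with
  | base =>
    intro j hj
    have h1 := bellman_number_one h hm hj
    have h2 := mul_pos h.s_pos (mul_pos (sub_pos.2 hq) (sub_pos.2 (hf.diagonal_lt h hlt hj)))
    simp only [← hf.eq] at h1
    linarith
  | succ i hi ih =>
    intro j hj
    obtain ⟨j, rfl⟩ : ∃ k, j = k + 1 := ⟨j - 1, by omega⟩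
    have h1 := bellman_number_succ h hm hi (show i ≤ j by omega)
    have h2 := mul_pos h.s_pos (mul_pos (sub_pos.2 hq) (sub_pos.2 (ih (j + 1) (by omega))))
    simp only [← hf.eq] at h1
    simp only [add_assoc] at *
    norm_num at *
    linarith

/-! ### Dependence on the joining probabilities -/

/-- Perturbation identity: the terminal rewards cancel, and changing `u` leaves a source term whose
sign is known once `g` decreases in the number present. -/
theorem IsReward.bellman_sub_eq (hf : IsReward a s q u f) (hg : IsReward a s q u' g) (i j : ℕ) :
    f i j - g i j = bellman a s q u 0 (fun i j => f i j - g i j) i j +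
      a * ((u' j - u j) * (g i j - g i (j + 1))) := by
  have h1 := bellman_sub (a := a) (s := s) (q := q) (u := u) 1 1 f g i j
  rw [sub_self] at h1
  rw [h1, ← hf.eq i j]
  have h2 := hg.eq i j
  unfold bellman at h2 ⊢
  linarith

theorem IsReward.le_of_le (h : BellmanData a s q u) (h' : BellmanData a s q u') (hlt : a + s < 1)
    (hf : IsReward a s q u f) (hg : IsReward a s q u' g) (hu : ∀ j, u j ≤ u' j) {i j : ℕ}
    (hi : 1 ≤ i) (hij : i ≤ j) : g i j ≤ f i j := by
  have hm := hg.queueMono h' hlt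
  refine sub_nonneg.1 (nonneg_of_bellman_le h hlt (d := fun i j => f i j - g i j) zero_le_one
    (fun i j _ _ => (abs_le.1 (hf.abs_sub_le hg i j)).1) (fun i j hi hij => ?_) hi hij)
  have h1 := hf.bellman_sub_eq hg i j
  have h2 := mul_nonneg h.a_pos.le
    (mul_nonneg (sub_nonneg.2 (hu j)) (sub_nonneg.2 (hm.number i j hi hij)))
  linarith

/-- The source is strictly positive at `(m, m)`, and this state is reached from `(m + 1, m + 1)` by
one successful service, of weight `s * q`. -/
theorem IsReward.diagonal_lt_of_lt (h : BellmanData a s q u) (h' : BellmanData a s q u')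
    (hlt : a + s < 1) (hq : q < 1) (hf : IsReward a s q u f) (hg : IsReward a s q u' g)
    (hu : ∀ j, u j ≤ u' j) {m : ℕ} (hm : 1 ≤ m) (hum : u m < u' m) :
    g (m + 1) (m + 1) < f (m + 1) (m + 1) := by
  have hgm := hg.queueMono h' hlt
  have hle : ∀ i j, 1 ≤ i → i ≤ j → 0 ≤ f i j - g i j := fun i j hi hij =>
    sub_nonneg.2 (hf.le_of_le h h' hlt hg hu hi hij)
  have hpos : ∀ i j, 1 ≤ i → i ≤ j → 0 ≤ bellman a s q u 0 (fun i j => f i j - g i j) i j := by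
    intro i j hi hij
    have := bellman_mono h (f := fun _ _ => 0) (le_refl (0 : ℝ)) hle hi hij
    rw [bellman_const] at this
    linarith
  have h1 : 0 < f m m - g m m := by
    have e := hf.bellman_sub_eq hg m m
    have h2 := mul_pos h.a_pos
      (mul_pos (sub_pos.2 hum) (sub_pos.2 (hg.number_lt h' hlt hq hm m le_rfl)))
    linarith [hpos m m hm le_rfl]
  have e := hf.bellman_sub_eq hg (m + 1) (m + 1)
  have h2 := mul_nonneg h.a_pos.le (mul_nonneg (sub_nonneg.2 (hu (m + 1)))
    (sub_nonneg.2 (hgm.number (m + 1) (m + 1) (by omega) le_rfl)))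
  rw [bellman_succ hm] at e
  have t1 := mul_nonneg h.a_pos.le (mul_nonneg (h.u_nonneg (m + 1))
    (hle (m + 1) (m + 2) (by omega) (by omega)))
  have t2 := mul_nonneg h.a_pos.le (mul_nonneg (sub_nonneg.2 (h.u_le (m + 1)))
    (hle (m + 1) (m + 1) (by omega) (by omega)))
  have t3 := mul_pos h.s_pos (mul_pos h.q_pos h1)
  have t4 := mul_nonneg h.s_pos.le (mul_nonneg (sub_nonneg.2 h.q_le)
    (hle m (m + 1) hm (by omega)))
  linarith

theorem IsReward.sub_le_of_abs_le (h : BellmanData a s q u) (hlt : a + s < 1)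
    (hf : IsReward a s q u f) (hg : IsReward a s q u' g) {δ : ℝ}
    (hu : ∀ j, |u' j - u j| ≤ δ) {i j : ℕ} (hi : 1 ≤ i) (hij : i ≤ j) :
    f i j - g i j ≤ δ / (1 - (a + s)) := by
  have hδ : 0 ≤ δ := (abs_nonneg _).trans (hu 0)
  have hβ : 0 < 1 - (a + s) := sub_pos.2 hlt
  set K := δ / (1 - (a + s)) with hK
  have hK0 : 0 ≤ K := by positivity
  -- `K` is the fixed point of `t ↦ (a + s) * t + δ`, so the constant `K` dominates the perturbation
  -- equation.
  have hKe : K = (a + s) * K + δ := by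
    rw [hK]
    field_simp
    ring
  refine sub_nonneg.1 (nonneg_of_bellman_le h hlt (d := fun i j => K - (f i j - g i j))
    zero_le_one (fun i j _ _ => ?_) (fun i j hi hij => ?_) hi hij)
  · have := (abs_le.1 (hf.abs_sub_le hg i j)).2
    linarith
  · have h1 := hf.bellman_sub_eq hg i j
    have h2 := bellman_sub (a := a) (s := s) (q := q) (u := u) K K (fun _ _ => K)
      (fun i j => f i j - g i j) i j
    rw [sub_self, bellman_const] at h2
    have h3 := bellman_mono h (c := 0) (c' := K) (f := fun i j => f i j - g i j) hK0
      (fun i j _ _ => le_rfl) hi hij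
    have h4 : a * ((u' j - u j) * (g i j - g i (j + 1))) ≤ δ := by
      have h5 : |(u' j - u j) * (g i j - g i (j + 1))| ≤ δ * 1 := by
        rw [abs_mul]
        refine mul_le_mul (hu j) ?_ (abs_nonneg _) hδ
        rw [abs_le]
        constructor <;> linarith [hg.nonneg i j, hg.le_one i j, hg.nonneg i (j + 1),
          hg.le_one i (j + 1)]
      have h6 := (abs_le.1 h5).2
      have h7 := mul_le_mul_of_nonneg_left h6 h.a_pos.le
      nlinarith [h.s_pos]
    linarith

/-- Here `γ` is the discount factor of one service time: a customer in position `i` stays for at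
least `i` attempts. -/
theorem IsReward.le_pow (h : BellmanData a s q u) (hlt : a + s < 1) (hf : IsReward a s q u f)
    {γ : ℝ} (hγ0 : 0 ≤ γ) (hγ1 : γ ≤ 1) (hγ : a * γ + s = γ) {i j : ℕ} (hi : 1 ≤ i)
    (hij : i ≤ j) : f i j ≤ γ ^ i := by
  refine sub_nonneg.1 (nonneg_of_bellman_le h hlt (d := fun i j => γ ^ i - f i j)
    zero_le_one (fun i j _ _ => ?_) (fun i j hi hij => ?_) hi hij)
  · have := hf.le_one i j
    have : 0 ≤ γ ^ i := by positivity
    linarith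
  · have h2 := bellman_sub (a := a) (s := s) (q := q) (u := u) 1 1 (fun i _ => γ ^ i) f i j
    rw [sub_self, ← hf.eq] at h2
    rw [h2]
    refine sub_le_sub_right ?_ _
    obtain ⟨i, rfl⟩ : ∃ k, i = k + 1 := ⟨i - 1, by omega⟩
    obtain ⟨j, rfl⟩ : ∃ k, j = k + 1 := ⟨j - 1, by omega⟩
    rcases Nat.eq_zero_or_pos i with rfl | hi'
    · rw [zero_add, bellman_one]
      have h3 := mul_le_mul_of_nonneg_left (pow_le_one₀ hγ0 hγ1 : γ ^ (j + 1) ≤ 1)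
        (mul_nonneg h.s_pos.le (sub_nonneg.2 h.q_le))
      linarith
    · rw [bellman_succ hi']
      have : γ ^ (i + 1) = a * γ ^ (i + 1) + s * γ ^ i := by
        rw [pow_succ', ← mul_assoc, ← add_mul, hγ]
      linarith

/-- Without feedback the sojourn consists of exactly `i` services, whatever the others do. -/
theorem IsReward.eq_pow (h : BellmanData a s 1 u) (hlt : a + s < 1) (hf : IsReward a s 1 u f)
    {γ : ℝ} (hγ0 : 0 ≤ γ) (hγ1 : γ ≤ 1) (hγ : a * γ + s = γ) {i j : ℕ} (hi : 1 ≤ i)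
    (hij : i ≤ j) : f i j = γ ^ i := by
  refine le_antisymm (hf.le_pow h hlt hγ0 hγ1 hγ hi hij) ?_
  refine sub_nonneg.1 (nonneg_of_bellman_le h hlt (d := fun i j => f i j - γ ^ i)
    zero_le_one (fun i j _ _ => ?_) (fun i j hi hij => ?_) hi hij)
  · have := hf.nonneg i j
    have : γ ^ i ≤ 1 := pow_le_one₀ hγ0 hγ1
    linarith
  · have h2 := bellman_sub (a := a) (s := s) (q := 1) (u := u) 1 1 f (fun i _ => γ ^ i) i j
    rw [sub_self, ← hf.eq] at h2
    rw [h2]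
    refine sub_le_sub_left ?_ _
    obtain ⟨i, rfl⟩ : ∃ k, i = k + 1 := ⟨i - 1, by omega⟩
    obtain ⟨j, rfl⟩ : ∃ k, j = k + 1 := ⟨j - 1, by omega⟩
    rcases Nat.eq_zero_or_pos i with rfl | hi'
    · rw [zero_add, bellman_one]
      linarith
    · rw [bellman_succ hi']
      have : γ ^ (i + 1) = a * γ ^ (i + 1) + s * γ ^ i := by
        rw [pow_succ', ← mul_assoc, ← add_mul, hγ]
      linarith

/-! ### No discounting -/

/-- From position `i`, the next `i` transitions are all successful services with probability `(s *
q) ^ i`, and then the chain is absorbed. Since nobody joins at level `N`, the chain stays in `j ≤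
N`. -/
theorem bellman_contract (h : BellmanData a s q u) (hsum : a + s = 1) {N : ℕ}
    (hN : ∀ j, N ≤ j → u j = 0) {d : ℕ → ℕ → ℝ} {D : ℝ}
    (hd : ∀ i j, 1 ≤ i → i ≤ j → j ≤ N → d i j ≤ D)
    (heq : ∀ i j, d i j = bellman a s q u 0 d i j) {i : ℕ} (hi : 1 ≤ i) :
    ∀ j, i ≤ j → j ≤ N → d i j ≤ (1 - (s * q) ^ i) * D := by
  have harr : ∀ i j, 1 ≤ i → i ≤ j → j ≤ N →
      a * (u j * d i (j + 1) + (1 - u j) * d i j) ≤ a * D := by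
    intro i j hi hij hjN
    refine mul_le_mul_of_nonneg_left ?_ h.a_pos.le
    have h1 : u j * d i (j + 1) ≤ u j * D := by
      rcases hjN.eq_or_lt with rfl | hlt
      · simp [hN]
      · exact mul_le_mul_of_nonneg_left (hd i (j + 1) hi (by omega) hlt) (h.u_nonneg j)
    have h2 := mul_le_mul_of_nonneg_left (hd i j hi hij hjN) (sub_nonneg.2 (h.u_le j))
    linarith
  have hs' := mul_nonneg h.s_pos.le (sub_nonneg.2 h.q_le)
  have ha : a = 1 - s := by linarith
  induction i, hi using Nat.le_induction with
  | base =>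
    intro j hij hjN
    have e := heq 1 j
    rw [bellman_one] at e
    have h1 := harr 1 j le_rfl hij hjN
    have h2 := mul_le_mul_of_nonneg_left (hd j j hij le_rfl hjN) hs'
    rw [e]
    rw [ha] at h1 ⊢
    linarith
  | succ i hi ih =>
    intro j hij hjN
    obtain ⟨j, rfl⟩ : ∃ k, j = k + 1 := ⟨j - 1, by omega⟩
    have e := heq (i + 1) (j + 1)
    rw [bellman_succ hi] at e
    have h1 := harr (i + 1) (j + 1) (by omega) hij hjN
    have h2 := mul_le_mul_of_nonneg_left (hd i (j + 1) hi (by omega) hjN) hs'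
    have h3 := mul_le_mul_of_nonneg_left (ih j (by omega) (by omega))
      (mul_nonneg h.s_pos.le h.q_pos.le)
    rw [e]
    have : (s * q) ^ (i + 1) = s * q * (s * q) ^ i := pow_succ' _ _
    rw [this]
    rw [ha] at h1 ⊢
    linarith

theorem IsReward.eq_one (h : BellmanData a s q u) (hsum : a + s = 1) {N : ℕ}
    (hN : ∀ j, N ≤ j → u j = 0) (hf : IsReward a s q u f) {i j : ℕ} (hi : 1 ≤ i) (hij : i ≤ j) :
    f i j = 1 := by
  refine le_antisymm (hf.le_one i j) (sub_nonpos.1 ?_)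
  -- The level must also contain the initial state, and it bounds all positions, which makes the
  -- contraction factor uniform.
  set K := max N j
  have hK : ∀ j, K ≤ j → u j = 0 := fun j hj => hN j ((le_max_left _ _).trans hj)
  have heq : ∀ i j, 1 - f i j = bellman a s q u 0 (fun i j => 1 - f i j) i j := by
    intro i j
    have h2 := bellman_sub (a := a) (s := s) (q := q) (u := u) 1 1 (fun _ _ => 1) f i j
    rw [sub_self, ← hf.eq, bellman_const, hsum, one_mul] at h2
    exact h2.symm
  have hsq : 0 < s * q := mul_pos h.s_pos h.q_pos
  have hsq1 : s * q ≤ 1 := by nlinarith [h.a_pos, h.q_le, h.s_pos]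
  have hε0 : 0 ≤ 1 - (s * q) ^ K := sub_nonneg.2 (pow_le_one₀ hsq.le hsq1)
  have hε1 : 1 - (s * q) ^ K < 1 := sub_lt_self _ (by positivity)
  have key : ∀ n : ℕ, ∀ i j, 1 ≤ i → i ≤ j → j ≤ K → 1 - f i j ≤ (1 - (s * q) ^ K) ^ n := by
    intro n
    induction n with
    | zero =>
      intro i j _ _ _
      linarith [hf.nonneg i j, pow_zero (1 - (s * q) ^ K)]
    | succ n ih =>
      intro i j hi hij hjK
      refine (bellman_contract h hsum hK ih heq hi j hij hjK).trans ?_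
      rw [pow_succ']
      refine mul_le_mul_of_nonneg_right ?_ (by positivity)
      exact sub_le_sub_left (pow_le_pow_of_le_one hsq.le hsq1 (hij.trans hjK)) _
  exact ge_of_tendsto' (tendsto_pow_atTop_nhds_zero_of_lt_one hε0 hε1)
    fun n => key n i j hi hij (le_max_right _ _)

end Bellman

/-! ### Joining probabilities as functions of the threshold -/

theorem joinProb_mono {x y : ℝ} (hx : 0 ≤ x) (hxy : x ≤ y) (i : ℕ) :
    joinProb x i ≤ joinProb y i := by
  rw [joinProb_eq hx, joinProb_eq (hx.trans hxy)]
  exact max_le_max le_rfl (min_le_min le_rfl (by linarith))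

theorem joinProb_succ_le {x : ℝ} (hx : 0 ≤ x) (i : ℕ) : joinProb x (i + 1) ≤ joinProb x i := by
  rw [joinProb_eq hx, joinProb_eq hx]
  refine max_le_max le_rfl (min_le_min le_rfl ?_)
  push_cast
  linarith

theorem joinProb_lt {x y : ℝ} (hx : 0 ≤ x) (hxy : x < y) {i : ℕ} (h1 : x < i) (h2 : i < y + 1) :
    joinProb x i < joinProb y i := by
  rw [joinProb_eq hx, joinProb_eq (hx.trans hxy.le)]
  refine max_lt (lt_max_of_lt_right (lt_min one_pos (by linarith))) (lt_max_of_lt_right ?_)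
  exact lt_min (min_lt_of_right_lt (by linarith)) (min_lt_of_right_lt (by linarith))

theorem abs_joinProb_sub_le {x y : ℝ} (hx : 0 ≤ x) (hy : 0 ≤ y) (i : ℕ) :
    |joinProb x i - joinProb y i| ≤ |x - y| := by
  rw [joinProb_eq hx, joinProb_eq hy]
  refine (abs_max_sub_max_le_max _ _ _ _).trans (max_le (by simp) ?_)
  refine (abs_min_sub_min_le_max _ _ _ _).trans (max_le (by simp) (le_of_eq ?_))
  congr 1
  ring

theorem joinProb_pos_iff {x : ℝ} (hx : 0 ≤ x) (i : ℕ) : 0 < joinProb x i ↔ (i : ℝ) < x + 1 := by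
  rw [joinProb_eq hx, lt_max_iff, lt_min_iff]
  constructor
  · rintro (h | h) <;> linarith [h]
  · exact fun h => Or.inr ⟨one_pos, by linarith⟩

theorem joinProb_lt_one_iff {x : ℝ} (hx : 0 ≤ x) (i : ℕ) : joinProb x i < 1 ↔ x < i := by
  rw [joinProb_eq hx, max_lt_iff, min_lt_iff]
  constructor
  · rintro ⟨-, h | h⟩ <;> linarith [h]
  · exact fun h => ⟨one_pos, Or.inr (by linarith)⟩

/-! ### Payoffs as functions of the position and of the threshold -/

namespace FeedbackQueue

variable (Q : FeedbackQueue) {α v x y : ℝ}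

theorem add_weight_eq (α : ℝ) :
    Q.arrivalRate / (Q.arrivalRate + Q.serviceRate + α) +
      Q.serviceRate / (Q.arrivalRate + Q.serviceRate + α) =
    (Q.arrivalRate + Q.serviceRate) / (Q.arrivalRate + Q.serviceRate + α) :=
  (add_div _ _ _).symm

theorem bellmanData (hα : 0 ≤ α) (hx : 0 ≤ x) :
    BellmanData (Q.arrivalRate / (Q.arrivalRate + Q.serviceRate + α))
      (Q.serviceRate / (Q.arrivalRate + Q.serviceRate + α)) Q.successProb
      (fun j => joinProb x (j + 1)) := by
  have h1 := Q.arrivalRate_pos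
  have h2 := Q.serviceRate_pos
  refine ⟨by positivity, by positivity, ?_, Q.successProb_pos, Q.successProb_le_one,
    fun j => (joinProb_mem_Icc hx _).1, fun j => (joinProb_mem_Icc hx _).2,
    fun j => joinProb_succ_le hx _⟩
  rw [add_weight_eq, div_le_one (by positivity)]
  linarith

theorem add_weight_lt_one (hα : 0 < α) :
    Q.arrivalRate / (Q.arrivalRate + Q.serviceRate + α) +
      Q.serviceRate / (Q.arrivalRate + Q.serviceRate + α) < 1 := by
  have h := Q.rate_pos
  rw [add_weight_eq, div_lt_one (by positivity)]
  linarith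

theorem isReward_reward (hα : 0 ≤ α) (hx : 0 ≤ x) :
    IsReward (Q.arrivalRate / (Q.arrivalRate + Q.serviceRate + α))
      (Q.serviceRate / (Q.arrivalRate + Q.serviceRate + α)) Q.successProb
      (fun j => joinProb x (j + 1)) (Q.reward α x) :=
  ⟨fun _ _ => Q.rewardFrom_nonneg α x _, fun _ _ => Q.rewardFrom_le_one x hα _,
    fun i j => Q.reward_first_step hα hx i j⟩

theorem payoff_zero_discount (hx : 0 ≤ x) {i : ℕ} (hi : 1 ≤ i) :
    Q.payoff 0 v x i i = 1 - v := by
  have hsum : Q.arrivalRate / (Q.arrivalRate + Q.serviceRate + 0) +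
      Q.serviceRate / (Q.arrivalRate + Q.serviceRate + 0) = 1 := by
    rw [add_weight_eq, add_zero, div_self Q.rate_pos.ne']
  rw [payoff_eq, (Q.isReward_reward le_rfl hx).eq_one (Q.bellmanData le_rfl hx) hsum
    (N := ⌈x⌉₊) (fun j hj => ?_) hi le_rfl]
  have h1 : ¬ 0 < joinProb x (j + 1) := by
    rw [joinProb_pos_iff hx]
    have := Nat.ceil_le.1 hj
    push_cast
    linarith
  exact le_antisymm (not_lt.1 h1) (joinProb_mem_Icc hx _).1

theorem payoff_succ_le (hα : 0 ≤ α) (hx : 0 ≤ x) {i : ℕ} (hi : 1 ≤ i) :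
    Q.payoff α v x (i + 1) (i + 1) ≤ Q.payoff α v x i i := by
  rcases hα.eq_or_lt with rfl | hα
  · rw [Q.payoff_zero_discount hx hi, Q.payoff_zero_discount hx (by omega)]
  · rw [payoff_eq, payoff_eq]
    have := ((Q.isReward_reward hα.le hx).queueMono (Q.bellmanData hα.le hx)
      (Q.add_weight_lt_one hα)).diagonal hi
    linarith

theorem payoff_anti_position (hα : 0 ≤ α) (hx : 0 ≤ x) {i k : ℕ} (hi : 1 ≤ i) (hik : i ≤ k) :
    Q.payoff α v x k k ≤ Q.payoff α v x i i := by
  induction k, hik using Nat.le_induction with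
  | base => exact le_rfl
  | succ k hk ih => exact (Q.payoff_succ_le hα hx (hi.trans hk)).trans ih

theorem payoff_lt_of_lt (hα : 0 < α) (hx : 0 ≤ x) {i k : ℕ} (hi : 1 ≤ i) (hik : i < k) :
    Q.payoff α v x k k < Q.payoff α v x i i := by
  refine (Q.payoff_anti_position hα.le hx (by omega) hik).trans_lt ?_
  rw [payoff_eq, payoff_eq]
  have := (Q.isReward_reward hα.le hx).diagonal_lt (Q.bellmanData hα.le hx)
      (Q.add_weight_lt_one hα) hi
  linarith

theorem payoff_anti_threshold (hα : 0 ≤ α) (hx : 0 ≤ x) (hxy : x ≤ y) {i : ℕ} (hi : 1 ≤ i) :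
    Q.payoff α v y i i ≤ Q.payoff α v x i i := by
  have hy := hx.trans hxy
  rcases hα.eq_or_lt with rfl | hα
  · rw [Q.payoff_zero_discount hx hi, Q.payoff_zero_discount hy hi]
  · rw [payoff_eq, payoff_eq]
    have := (Q.isReward_reward hα.le hx).le_of_le (Q.bellmanData hα.le hx)
      (Q.bellmanData hα.le hy) (Q.add_weight_lt_one hα) (Q.isReward_reward hα.le hy)
      (fun j => joinProb_mono hx hxy _) hi le_rfl
    linarith

theorem payoff_threshold_lt (hα : 0 < α) (hq : Q.successProb < 1) (hx : 0 ≤ x) (hxy : x < y)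
    {m : ℕ} (hm : 1 ≤ m) (hxm : x < m + 1) (hym : (m : ℝ) < y) :
    Q.payoff α v y (m + 1) (m + 1) < Q.payoff α v x (m + 1) (m + 1) := by
  have hy := hx.trans hxy.le
  rw [payoff_eq, payoff_eq]
  have := (Q.isReward_reward hα.le hx).diagonal_lt_of_lt (Q.bellmanData hα.le hx)
    (Q.bellmanData hα.le hy) (Q.add_weight_lt_one hα) hq (Q.isReward_reward hα.le hy)
    (fun j => joinProb_mono hx hxy.le _) hm
    (joinProb_lt hx hxy (by push_cast; linarith) (by push_cast; linarith))
  linarith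

theorem abs_payoff_sub_le (hα : 0 < α) (hx : 0 ≤ x) (hy : 0 ≤ y) {i : ℕ} (hi : 1 ≤ i) :
    |Q.payoff α v x i i - Q.payoff α v y i i| ≤
      (1 - (Q.arrivalRate / (Q.arrivalRate + Q.serviceRate + α) +
        Q.serviceRate / (Q.arrivalRate + Q.serviceRate + α)))⁻¹ * |x - y| := by
  have h1 := (Q.isReward_reward hα.le hx).sub_le_of_abs_le (Q.bellmanData hα.le hx)
    (Q.add_weight_lt_one hα) (Q.isReward_reward hα.le hy) (δ := |x - y|)
    (fun j => (abs_joinProb_sub_le hy hx _).trans_eq (abs_sub_comm y x)) hi le_rfl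
  have h2 := (Q.isReward_reward hα.le hy).sub_le_of_abs_le (Q.bellmanData hα.le hy)
    (Q.add_weight_lt_one hα) (Q.isReward_reward hα.le hx) (δ := |x - y|)
    (fun j => abs_joinProb_sub_le hx hy _) hi le_rfl
  rw [payoff_eq, payoff_eq, inv_mul_eq_div, abs_le]
  constructor <;> linarith

theorem continuousOn_payoff (hα : 0 < α) {i : ℕ} (hi : 1 ≤ i) :
    ContinuousOn (fun x => Q.payoff α v x i i) (Ici 0) := by
  have hK : 0 ≤ (1 - (Q.arrivalRate / (Q.arrivalRate + Q.serviceRate + α) +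
        Q.serviceRate / (Q.arrivalRate + Q.serviceRate + α)))⁻¹ :=
    inv_nonneg.2 (sub_nonneg.2 (Q.add_weight_lt_one hα).le)
  refine (LipschitzOnWith.of_dist_le_mul (K := ⟨_, hK⟩) fun x hx y hy => ?_).continuousOn
  exact Q.abs_payoff_sub_le hα hx hy hi

theorem serviceWeight_eq (hα : 0 ≤ α) :
    Q.arrivalRate / (Q.arrivalRate + Q.serviceRate + α) * (Q.serviceRate / (Q.serviceRate + α)) +
      Q.serviceRate / (Q.arrivalRate + Q.serviceRate + α) =
    Q.serviceRate / (Q.serviceRate + α) := by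
  have h1 := Q.arrivalRate_pos
  have h2 := Q.serviceRate_pos
  have : Q.arrivalRate + Q.serviceRate + α ≠ 0 := by positivity
  have : Q.serviceRate + α ≠ 0 := by positivity
  field_simp
  ring

theorem serviceWeight_mem_Ico (hα : 0 < α) :
    Q.serviceRate / (Q.serviceRate + α) ∈ Ico (0 : ℝ) 1 := by
  have h2 := Q.serviceRate_pos
  refine ⟨by positivity, ?_⟩
  rw [div_lt_one (by positivity)]
  linarith

theorem payoff_le_pow (hα : 0 < α) (hx : 0 ≤ x) {i : ℕ} (hi : 1 ≤ i) :
    Q.payoff α v x i i ≤ (Q.serviceRate / (Q.serviceRate + α)) ^ i - v := by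
  have hγ := Q.serviceWeight_mem_Ico hα
  rw [payoff_eq]
  exact sub_le_sub_right ((Q.isReward_reward hα.le hx).le_pow (Q.bellmanData hα.le hx)
    (Q.add_weight_lt_one hα) hγ.1 hγ.2.le (Q.serviceWeight_eq hα.le) hi le_rfl) v

theorem payoff_eq_pow (hα : 0 < α) (hq : Q.successProb = 1) (hx : 0 ≤ x) {i : ℕ} (hi : 1 ≤ i) :
    Q.payoff α v x i i = (Q.serviceRate / (Q.serviceRate + α)) ^ i - v := by
  have hγ := Q.serviceWeight_mem_Ico hα
  have h1 := Q.isReward_reward hα.le hx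
  have h2 := Q.bellmanData hα.le hx
  rw [hq] at h1 h2
  rw [payoff_eq, h1.eq_pow h2 (Q.add_weight_lt_one hα) hγ.1 hγ.2.le (Q.serviceWeight_eq hα.le) hi
    le_rfl]

/-- For thresholds at most 1 nobody joins behind a lone tagged customer, so her reward is `μq/(μq +
α)`. This degeneracy causes the continuum of equilibria. -/
theorem payoff_one_eq (hα : 0 ≤ α) (hx : 0 ≤ x) (hx1 : x ≤ 1) :
    Q.payoff α v x 1 1 = Q.payoff α v 0 1 1 := by
  have h1 : ∀ y : ℝ, 0 ≤ y → y ≤ 1 → joinProb y 2 = 0 := fun y hy hy1 =>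
    le_antisymm (not_lt.1 fun h => by
      have := (joinProb_pos_iff hy 2).1 h
      push_cast at this
      linarith) (joinProb_mem_Icc hy 2).1
  have h2 : ∀ y : ℝ, 0 ≤ y → y ≤ 1 → Q.reward α y 1 1 * (Q.serviceRate * Q.successProb + α) =
      Q.serviceRate * Q.successProb := by
    intro y hy hy1
    have e := Q.reward_first_step hα hy 1 1
    have hr := Q.rate_pos
    have : Q.arrivalRate + Q.serviceRate + α ≠ 0 := by positivity
    simp only [one_add_one_eq_two, h1 y hy hy1, if_true] at e
    field_simp at e
    linarith
  have hne : Q.serviceRate * Q.successProb + α ≠ 0 := by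
    have := Q.serviceRate_pos
    have := Q.successProb_pos
    positivity
  rw [payoff_eq, payoff_eq, mul_right_cancel₀ hne
    ((h2 x hx hx1).trans (h2 0 le_rfl zero_le_one).symm)]

/-! ### Equilibrium conditions -/

theorem isNashThreshold_iff : Q.IsNashThreshold α v x ↔ 0 ≤ x ∧ ∀ i : ℕ, 1 ≤ i → i ≤ ⌈x⌉₊ + 1 →
    ((i : ℝ) < x + 1 → 0 ≤ Q.payoff α v x i i) ∧ (x < i → Q.payoff α v x i i ≤ 0) := by
  refine and_congr_right fun hx => forall_congr' fun i => forall_congr' fun hi =>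
    forall_congr' fun hi' => ?_
  rw [← joinProb_pos_iff hx, ← joinProb_lt_one_iff hx]
  have hp := joinProb_mem_Icc hx i
  constructor
  · intro h
    refine ⟨fun h0 => ?_, fun h1 => ?_⟩
    · have := h 0 ⟨le_rfl, zero_le_one⟩
      rw [zero_mul] at this
      exact nonneg_of_mul_nonneg_right this h0
    · have := h 1 ⟨zero_le_one, le_rfl⟩
      by_contra! hc
      nlinarith
  · rintro ⟨h0, h1⟩ a ha
    rcases hp.1.eq_or_lt with he | hlt
    · have := h1 (by linarith)
      nlinarith [ha.1]
    · rcases hp.2.eq_or_lt with he | hlt'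
      · rw [he]
        nlinarith [h0 hlt, ha.2]
      -- Genuine randomization forces indifference.
      · rw [le_antisymm (h1 hlt') (h0 hlt)]
        simp

theorem IsNashThreshold.payoff_nonneg {Q : FeedbackQueue} (h : Q.IsNashThreshold α v x) {i : ℕ}
    (hi : 1 ≤ i) (hix : (i : ℝ) < x + 1) : 0 ≤ Q.payoff α v x i i := by
  rw [isNashThreshold_iff] at h
  refine (h.2 i hi ?_).1 hix
  have h1 : (i : ℝ) < (⌈x⌉₊ + 1 : ℕ) := by
    push_cast
    linarith [Nat.le_ceil x]
  exact (Nat.cast_lt.1 h1).le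

theorem IsNashThreshold.payoff_nonpos {Q : FeedbackQueue} (h : Q.IsNashThreshold α v x) :
    Q.payoff α v x (⌊x⌋₊ + 1) (⌊x⌋₊ + 1) ≤ 0 := by
  have h' := (isNashThreshold_iff Q).1 h
  refine (h'.2 _ (by omega) (by have := Nat.floor_le_ceil x; omega)).2 ?_
  push_cast
  exact Nat.lt_floor_add_one x

theorem isNashThreshold_natCast {m : ℕ} (hα : 0 ≤ α)
    (h1 : Q.payoff α v m (m + 1) (m + 1) ≤ 0) (h2 : 1 ≤ m → 0 ≤ Q.payoff α v m m m) :
    Q.IsNashThreshold α v m := by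
  have hm0 : (0 : ℝ) ≤ m := Nat.cast_nonneg m
  refine (isNashThreshold_iff Q).2 ⟨hm0, fun i hi _ => ⟨fun h => ?_, fun h => ?_⟩⟩
  · have : i < m + 1 := by exact_mod_cast h
    exact (h2 (by omega)).trans (Q.payoff_anti_position hα hm0 hi (by omega))
  · have : m < i := by exact_mod_cast h
    exact (Q.payoff_anti_position hα hm0 (by omega) this).trans h1

theorem isNashThreshold_of_root {m : ℕ} (hα : 0 ≤ α) (hx : x ∈ Icc (m : ℝ) (m + 1))
    (h : Q.payoff α v x (m + 1) (m + 1) = 0) : Q.IsNashThreshold α v x := by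
  have hx0 : 0 ≤ x := (Nat.cast_nonneg m).trans hx.1
  refine (isNashThreshold_iff Q).2 ⟨hx0, fun i hi _ => ⟨fun h' => ?_, fun h' => ?_⟩⟩
  · have : (i : ℝ) < (m + 2 : ℕ) := by
      push_cast
      linarith [hx.2]
    have : i < m + 2 := by exact_mod_cast this
    exact h.ge.trans (Q.payoff_anti_position hα hx0 hi (by omega))
  · have : m < i := by exact_mod_cast hx.1.trans_lt h'
    exact (Q.payoff_anti_position hα hx0 (by omega) this).trans h.le

/-- No equilibrium threshold lies below `m` if a customer in position `m` gains under
every smaller threshold. -/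
theorem IsNashThreshold.le_of_payoff_pos {Q : FeedbackQueue} (hα : 0 ≤ α)
    (h : Q.IsNashThreshold α v x) {m : ℕ} (hpos : x < m → 0 < Q.payoff α v x m m) :
    (m : ℝ) ≤ x := by
  by_contra! hlt
  have hf : ⌊x⌋₊ < m := (Nat.floor_lt h.1).2 hlt
  have h1 := Q.payoff_anti_position (v := v) hα h.1 (by omega : 1 ≤ ⌊x⌋₊ + 1) hf
  linarith [h.payoff_nonpos, hpos hlt]

theorem IsNashThreshold.le_of_payoff_neg {Q : FeedbackQueue}
    (h : Q.IsNashThreshold α v x) {m : ℕ}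
    (hneg : (m : ℝ) < x → Q.payoff α v x (m + 1) (m + 1) < 0) : x ≤ m := by
  by_contra! hlt
  have := h.payoff_nonneg (i := m + 1) (by omega) (by push_cast; linarith)
  linarith [hneg hlt]

/-! ### The cases of the theorem -/

theorem setOf_isNashThreshold_of_neg (hα : 0 ≤ α) (h : Q.payoff α v 0 1 1 < 0) :
    {x | Q.IsNashThreshold α v x} = {0} := by
  refine Subset.antisymm (fun x hx => ?_) (singleton_subset_iff.2 ?_)
  · have := IsNashThreshold.le_of_payoff_neg (m := 0) hx fun _ =>
      (Q.payoff_anti_threshold hα le_rfl hx.1 le_rfl).trans_lt h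
    exact le_antisymm (by simpa using this) hx.1
  · have := Q.isNashThreshold_natCast (m := 0) (v := v) hα (by simpa using h.le) (by simp)
    simpa using this

theorem isNashThreshold_of_zero (hα : 0 ≤ α) (h : Q.payoff α v 0 1 1 = 0) (hx : x ∈ Icc (0 : ℝ) 1) :
    Q.IsNashThreshold α v x :=
  Q.isNashThreshold_of_root (m := 0) hα (by simpa using hx)
    ((Q.payoff_one_eq hα hx.1 hx.2).trans h)

theorem setOf_isNashThreshold_of_zero (hα : 0 < α) (h : Q.payoff α v 0 1 1 = 0) :
    {x | Q.IsNashThreshold α v x} = Icc 0 1 := by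
  refine Subset.antisymm (fun x hx => ⟨hx.1, ?_⟩) fun x hx => Q.isNashThreshold_of_zero hα.le h hx
  have := IsNashThreshold.le_of_payoff_neg (m := 1) hx fun _ =>
    (Q.payoff_lt_of_lt hα hx.1 le_rfl one_lt_two).trans_le
      ((Q.payoff_anti_threshold hα.le le_rfl hx.1 le_rfl).trans h.le)
  simpa using this

theorem setOf_isNashThreshold_of_natCast (hα : 0 < α) (hq : Q.successProb < 1) {m : ℕ}
    (hm : 1 ≤ m) (h1 : Q.payoff α v m (m + 1) (m + 1) ≤ 0) (h2 : 0 ≤ Q.payoff α v m m m)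
    (h0 : Q.payoff α v 0 1 1 ≠ 0) : {x | Q.IsNashThreshold α v x} = {(m : ℝ)} := by
  have hm0 : (0 : ℝ) ≤ m := Nat.cast_nonneg m
  refine Subset.antisymm (fun x hx => ?_)
    (singleton_subset_iff.2 (Q.isNashThreshold_natCast hα.le h1 fun _ => h2))
  refine le_antisymm (IsNashThreshold.le_of_payoff_neg hx fun hlt => ?_)
    (IsNashThreshold.le_of_payoff_pos hα.le hx fun hlt => ?_)
  · exact (Q.payoff_threshold_lt hα hq hm0 hlt hm (by linarith) hlt).trans_le h1
  -- For `m = 1` strict monotonicity in the threshold fails on `[0, 1]`; there `h0` excludes payoff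
  -- zero.
  · rcases hm.eq_or_lt with rfl | hm'
    · have hlt1 : x < 1 := by simpa using hlt
      rw [Nat.cast_one, Q.payoff_one_eq hα.le zero_le_one le_rfl] at h2
      rw [Q.payoff_one_eq hα.le hx.1 hlt1.le]
      exact lt_of_le_of_ne h2 h0.symm
    · obtain ⟨k, rfl⟩ : ∃ k, m = k + 1 := ⟨m - 1, by omega⟩
      push_cast at hlt h2 ⊢
      exact h2.trans_lt (Q.payoff_threshold_lt hα hq hx.1 hlt (by omega) hlt (by linarith))

theorem exists_root {m : ℕ} (hα : 0 ≤ α) (hm : 1 ≤ m)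
    (h1 : Q.payoff α v (m + 1) (m + 1) (m + 1) < 0) (h2 : 0 < Q.payoff α v m (m + 1) (m + 1)) :
    ∃ χ ∈ Ioo (m : ℝ) (m + 1),
      {x ∈ Ioo (m : ℝ) (m + 1) | Q.payoff α v x (m + 1) (m + 1) = 0} = {χ} ∧
      {x | Q.IsNashThreshold α v x} = {χ} := by
  have hm0 : (0 : ℝ) ≤ m := Nat.cast_nonneg m
  have hm1 : (0 : ℝ) ≤ m + 1 := by positivity
  have hi : 1 ≤ m + 1 := by omega
  -- If `α = 0` or `q = 1`, the payoff does not depend on the threshold, so it could not change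
  -- sign.
  have hα' : 0 < α := by
    refine hα.lt_of_ne ?_
    rintro rfl
    rw [Q.payoff_zero_discount hm1 hi] at h1
    rw [Q.payoff_zero_discount hm0 hi] at h2
    linarith
  have hq : Q.successProb < 1 := by
    refine Q.successProb_le_one.lt_of_ne fun hq => ?_
    rw [Q.payoff_eq_pow hα' hq hm1 hi] at h1
    rw [Q.payoff_eq_pow hα' hq hm0 hi] at h2
    linarith
  obtain ⟨χ, hχ, hroot⟩ := intermediate_value_Ioo' (by linarith : (m : ℝ) ≤ m + 1)
    ((Q.continuousOn_payoff (v := v) hα' hi).mono fun x hx => hm0.trans hx.1) ⟨h1, h2⟩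
  have huniq : ∀ x ∈ Ioo (m : ℝ) (m + 1), Q.payoff α v x (m + 1) (m + 1) = 0 → x = χ := by
    intro x hx hx0
    simp only at hroot
    rcases lt_trichotomy x χ with hlt | rfl | hlt
    · have := Q.payoff_threshold_lt (v := v) hα' hq (hm0.trans hx.1.le) hlt hm hx.2 hχ.1
      linarith
    · rfl
    · have := Q.payoff_threshold_lt (v := v) hα' hq (hm0.trans hχ.1.le) hlt hm hχ.2 hx.1
      linarith
  refine ⟨χ, hχ, Subset.antisymm (fun x hx => huniq x hx.1 hx.2)
    (singleton_subset_iff.2 ⟨hχ, hroot⟩), Subset.antisymm (fun x hx => ?_)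
    (singleton_subset_iff.2 (Q.isNashThreshold_of_root hα ⟨hχ.1.le, hχ.2.le⟩ hroot))⟩
  -- Under a threshold at most `m`, position `m + 1` is still profitable, hence so is the first
  -- position not joined surely.
  have hx1 : (m : ℝ) < x := by
    by_contra! hle
    have hf : ⌊x⌋₊ ≤ m := Nat.floor_le_of_le hle
    have t1 := Q.payoff_anti_threshold (v := v) hα hx.1 hle hi
    have t2 := Q.payoff_anti_position (v := v) hα hx.1 (by omega : 1 ≤ ⌊x⌋₊ + 1)
      (Nat.succ_le_succ hf)
    linarith [IsNashThreshold.payoff_nonpos hx]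
  have hnn := IsNashThreshold.payoff_nonneg hx hi (by push_cast; linarith)
  have hx2 : x < m + 1 := by
    by_contra! hle
    linarith [Q.payoff_anti_threshold (v := v) hα hm1 hle hi]
  refine huniq x ⟨hx1, hx2⟩ (le_antisymm ?_ hnn)
  have hf : ⌊x⌋₊ = m := (Nat.floor_eq_iff hx.1).2 ⟨hx1.le, hx2⟩
  simpa [hf] using IsNashThreshold.payoff_nonpos hx

/-- Take the least `m` for which joining behind `m` customers does not pay under threshold `m`.
Either position `m` pays under that threshold, or minimality yields the sign change for `m - 1`. -/
theorem exists_case (hα : 0 < α) (hv : 0 < v) (h0 : 0 < Q.payoff α v 0 1 1) :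
    (∃ m : ℕ, 1 ≤ m ∧ Q.payoff α v m (m + 1) (m + 1) ≤ 0 ∧ 0 ≤ Q.payoff α v m m m) ∨
    (∃ m : ℕ, 1 ≤ m ∧ Q.payoff α v (m + 1) (m + 1) (m + 1) < 0 ∧
      0 < Q.payoff α v m (m + 1) (m + 1)) := by
  classical
  have hγ := Q.serviceWeight_mem_Ico hα
  have hex : ∃ m : ℕ, Q.payoff α v m (m + 1) (m + 1) ≤ 0 := by
    obtain ⟨n, hn⟩ := exists_pow_lt_of_lt_one hv hγ.2
    refine ⟨n, (Q.payoff_le_pow hα (Nat.cast_nonneg n) (by omega)).trans ?_⟩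
    exact sub_nonpos.2 ((pow_le_pow_of_le_one hγ.1 hγ.2.le n.le_succ).trans hn.le)
  have hspec := Nat.find_spec hex
  have hmin := fun k => Nat.find_min hex (m := k)
  set m := Nat.find hex
  have hm : 1 ≤ m := by
    by_contra! hc
    have : m = 0 := by omega
    rw [this, Nat.cast_zero, zero_add] at hspec
    linarith
  by_cases hc : 0 ≤ Q.payoff α v m m m
  · exact Or.inl ⟨m, hm, hspec, hc⟩
  · obtain ⟨k, hk⟩ : ∃ k, m = k + 1 := ⟨m - 1, by omega⟩
    have hk' := not_le.1 (hmin k (by omega))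
    rw [hk] at hc
    push_cast at hc
    refine Or.inr ⟨k, ?_, not_le.1 hc, hk'⟩
    by_contra! hk0
    obtain rfl : k = 0 := by omega
    rw [Nat.cast_zero, zero_add, zero_add, Q.payoff_one_eq hα.le zero_le_one le_rfl] at hc
    exact hc h0.le

end FeedbackQueue

end

theorem mainTheorem1 (Q : FeedbackQueue) (α v : ℝ) (hα : 0 ≤ α) :
    -- threshold `0`
    (Q.payoff α v 0 1 1 < 0 → {x | Q.IsNashThreshold α v x} = {0}) ∧
    -- any threshold in `[0, 1]`
    (Q.payoff α v 0 1 1 = 0 →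
      (∀ ζ ∈ Icc (0 : ℝ) 1, Q.IsNashThreshold α v ζ) ∧
      (0 < α → {x | Q.IsNashThreshold α v x} = Icc 0 1)) ∧
    -- integer threshold `m`
    (∀ m : ℕ, 1 ≤ m →
      Q.payoff α v m (m + 1) (m + 1) ≤ 0 → 0 ≤ Q.payoff α v m m m →
      Q.IsNashThreshold α v m ∧
      (0 < α → Q.successProb < 1 → Q.payoff α v 0 1 1 ≠ 0 →
        {x | Q.IsNashThreshold α v x} = {(m : ℝ)})) ∧
    -- the root `χ` in `(m, m + 1)`
    (∀ m : ℕ, 1 ≤ m →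
      Q.payoff α v (m + 1) (m + 1) (m + 1) < 0 → 0 < Q.payoff α v m (m + 1) (m + 1) →
      ∃ χ ∈ Ioo (m : ℝ) (m + 1),
        {x ∈ Ioo (m : ℝ) (m + 1) | Q.payoff α v x (m + 1) (m + 1) = 0} = {χ} ∧
        {x | Q.IsNashThreshold α v x} = {χ}) ∧
    -- one of the four cases always occurs
    (0 < α → 0 < v →
      Q.payoff α v 0 1 1 < 0 ∨ Q.payoff α v 0 1 1 = 0 ∨
      (∃ m : ℕ, 1 ≤ m ∧
        Q.payoff α v m (m + 1) (m + 1) ≤ 0 ∧ 0 ≤ Q.payoff α v m m m) ∨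
      (∃ m : ℕ, 1 ≤ m ∧
        Q.payoff α v (m + 1) (m + 1) (m + 1) < 0 ∧ 0 < Q.payoff α v m (m + 1) (m + 1))) := by
  refine ⟨Q.setOf_isNashThreshold_of_neg hα, fun h => ⟨fun _ hζ => Q.isNashThreshold_of_zero hα h hζ,
    fun hα' => Q.setOf_isNashThreshold_of_zero hα' h⟩, fun m hm h1 h2 =>
    ⟨Q.isNashThreshold_natCast hα h1 fun _ => h2, fun hα' hq h0 =>
      Q.setOf_isNashThreshold_of_natCast hα' hq hm h1 h2 h0⟩,
    fun m hm h1 h2 => Q.exists_root hα hm h1 h2, fun hα' hv => ?_⟩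
  rcases lt_trichotomy (Q.payoff α v 0 1 1) 0 with h | h | h
  · exact Or.inl h
  · exact Or.inr (Or.inl h)
  · exact Or.inr (Or.inr (Q.exists_case hα' hv h))
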